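/- \textbf{Theorem (Duality Theorem for Finitely Approximable Subvarieties).} Let $\mathbf V$ be a variety of Heyting algebras that is \emph{finitely approximable}, i.e. every finitely generated free $\mathbf V$-algebra embeds into a product of finite $\mathbf V$-algebras. Then the category $\mathbf{HD}^{\mathbf V}$ is dual to the category $\mathbf{M_H}^{\mathbf V}$, that is, there is an equivalence of categories $(\mathbf{M_H}^{\mathbf V})^{op}\simeq \mathbf{HD}^{\mathbf V}$. Here: \begin{itemize} \item $\mathbf{HD}^{\mathbf V}$ is the category of $\mathbf V$-algebras freely generated by a finite distributive lattice, with Heyting algebra morphisms. A $\mathbf V$-algebra $A$ is freely generated by the bounded distributive lattice $D$ if there is a bound-preserving lattice morphism $\eta:D\to A$ such that every bound-preserving lattice morphism $g$ from $D$ to a $\mathbf V$-algebra $B$ is $\varphi\circ\eta$ for a unique Heyting algebra morphism $\varphi:A\to B$. \item A finite poset $P$ is rooted if it has a greatest element $\rho(P)$. A monotone map $f:Q\to P$ is open if whenever $p\le f(q)$ there is $q'\le q$ with $f(q')=p$. $\mathcal D(P)$ is the Heyting algebra of downward closed subsets of $P$, and $\mathbf P_0^{\mathbf V}$ is the category of finite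 rooted posets $P$ with $\mathcal D(P)\in\mathbf V$ and open maps. \item For a finite poset $L$, the evaluation sheaf $h_L$ is the presheaf over $\mathbf P_0^{\mathbf V}$ sending $P$ to the set of monotone maps ($L$-evaluations) $u:P\to L$, with open maps acting by precomposition. \item For $u:P\to L$ and $p\in P$, let $u_p$ be the restriction of $u$ to $\downarrow p$. For $u:P\to L$ and $v:Q\to L$, put $u\sim_0 v$ iff $u(\rho(P))=v(\rho(Q))$, and $u\sim_{n+1}v$ iff for every $p\in P$ there is $q\in Q$ with $u_p\sim_n v_q$ and for every $q\in Q$ there is $p\in P$ with $u_p\sim_n v_q$. \item A natural transformation $\psi:h_L\to h_M$ has b-index $n$ if for all $P,Q\in\mathbf P_0^{\mathbf V}$, $u\in h_L(P)$ and $v\in h_L(Q)$, $u\sim_n v$ implies $\psi_P(u)\sim_0\psi_Q(v)$. \item $\mathbf{M_H}^{\mathbf V}$ is the category whose objects are the evaluation sheaves $h_L$, for $L$ a finite poset, and whose arrows are the natural transformations that have a b-index $n$ for some $n\ge 0$. \end{itemize} -/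

import Mathlib

open CategoryTheory Opposite

universe u

/-! ### Varieties of Heyting algebras -/

/-- Terms in the signature of Heyting algebras, with variables `x₀, x₁, x₂, …`. -/
inductive HeytingTerm : Type
  | var : ℕ → HeytingTerm
  | bot : HeytingTerm
  | top : HeytingTerm
  | inf : HeytingTerm → HeytingTerm → HeytingTerm
  | sup : HeytingTerm → HeytingTerm → HeytingTerm
  | imp : HeytingTerm → HeytingTerm → HeytingTerm

/-- The value of a term in a Heyting algebra under an assignment of the variables. -/
def HeytingTerm.eval {H : Type*} [HeytingAlgebra H] (x : ℕ → H) : HeytingTerm → H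
  | .var i => x i
  | .bot => ⊥
  | .top => ⊤
  | .inf s t => s.eval x ⊓ t.eval x
  | .sup s t => s.eval x ⊔ t.eval x
  | .imp s t => s.eval x ⇨ t.eval x

/-- A variety of Heyting algebras, given by a set of defining equations `s ≈ t`. -/
structure HeytingVariety : Type where
  equations : Set (HeytingTerm × HeytingTerm)

/-- `H` is a `V`-algebra: it satisfies all the equations that define `V`. -/
def HeytingVariety.Mem (V : HeytingVariety) (H : Type*) [HeytingAlgebra H] : Prop :=
  ∀ e ∈ V.equations, ∀ x : ℕ → H, e.1.eval x = e.2.eval x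

/-- Heyting homomorphisms commute with the evaluation of terms. -/
theorem HeytingTerm.map_eval {H K : Type*} [HeytingAlgebra H] [HeytingAlgebra K]
    (φ : HeytingHom H K) (x : ℕ → H) (t : HeytingTerm) :
    φ (t.eval x) = t.eval (fun i => φ (x i)) := by
  induction t with
  | var i => rfl
  | bot => exact map_bot φ
  | top => exact map_top φ
  | inf s t hs ht => simp only [HeytingTerm.eval, map_inf, hs, ht]
  | sup s t hs ht => simp only [HeytingTerm.eval, map_sup, hs, ht]
  | imp s t hs ht => simp only [HeytingTerm.eval, map_himp, hs, ht]

/-- Varieties are closed under homomorphic images. -/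
theorem HeytingVariety.Mem.of_surjective {V : HeytingVariety} {H K : Type*} [HeytingAlgebra H]
    [HeytingAlgebra K] (hH : V.Mem H) (φ : HeytingHom H K) (hφ : Function.Surjective φ) :
    V.Mem K := by
  intro e he x
  choose y hy using fun i => hφ (x i)
  have h := congrArg φ (hH e he y)
  simpa only [HeytingTerm.map_eval, hy] using h

/-- `F` is the free `V`-algebra on the set `X`, with `η : X → F` the inclusion of generators. -/
def HeytingVariety.IsFreeOn (V : HeytingVariety) {X : Type*} {F : Type u} [HeytingAlgebra F]
    (η : X → F) : Prop :=
  V.Mem F ∧ ∀ (B : Type u) [HeytingAlgebra B], V.Mem B → ∀ g : X → B,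
    ∃! φ : HeytingHom F B, ∀ x, φ (η x) = g x

/-- `A` is the `V`-algebra freely generated by the bounded distributive lattice `D`, with
`η : D → A` the canonical morphism: every morphism of bounded lattices from `D` to a `V`-algebra
extends along `η` to a unique morphism of Heyting algebras on `A`. -/
def HeytingVariety.IsFreeOver (V : HeytingVariety) {D : Type*} [DistribLattice D] [BoundedOrder D]
    {A : Type u} [HeytingAlgebra A] (η : BoundedLatticeHom D A) : Prop :=
  V.Mem A ∧ ∀ (B : Type u) [HeytingAlgebra B], V.Mem B → ∀ g : BoundedLatticeHom D B,
    ∃! φ : HeytingHom A B, ∀ d, φ (η d) = g d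

/-- `V` is finitely approximable: every finitely generated free `V`-algebra embeds into a
product of finite `V`-algebras. -/
def HeytingVariety.FinitelyApproximable (V : HeytingVariety) : Prop :=
  ∀ (n : ℕ) (F : Type u) [HeytingAlgebra F] (η : Fin n → F), V.IsFreeOn η →
    ∃ (ι : Type u) (B : ι → HeytAlg.{u}), (∀ i, Finite (B i) ∧ V.Mem (B i)) ∧
      ∃ φ : HeytingHom F (∀ i, B i), Function.Injective φ

/-- The objects of `HDCat V`: Heyting algebras that are freely generated, as `V`-algebras, by
some finite distributive lattice. -/
def HeytingVariety.isFreeOverFinite (V : HeytingVariety) : ObjectProperty HeytAlg.{u} := fun A =>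
  ∃ (D : Type u) (_ : DistribLattice D) (_ : BoundedOrder D) (_ : Finite D)
    (η : BoundedLatticeHom D A), V.IsFreeOver η

/-- The category of `V`-algebras freely generated by a finite distributive lattice, with all
Heyting algebra morphisms as arrows. -/
abbrev HDCat (V : HeytingVariety) := (HeytingVariety.isFreeOverFinite.{u} V).FullSubcategory

/-! ### Finite rooted posets and open maps -/

/-- A finite rooted poset: a finite poset with a greatest element `⊤`, its root. -/
structure FinRootedPoset : Type (u + 1) where
  carrier : Type u
  [partialOrder : PartialOrder carrier]
  [orderTop : OrderTop carrier]
  [finite : Finite carrier]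

namespace FinRootedPoset

instance : CoeSort FinRootedPoset.{u} (Type u) := ⟨carrier⟩

attribute [instance] partialOrder orderTop finite

/-- Open maps: monotone maps sending principal downsets onto principal downsets. They need not
preserve roots. -/
@[ext]
structure Hom (Q P : FinRootedPoset.{u}) : Type u where
  toOrderHom : Q →o P
  isOpen : ∀ (q : Q) (p : P), p ≤ toOrderHom q → ∃ q' ≤ q, toOrderHom q' = p

instance : Category FinRootedPoset.{u} where
  Hom := Hom
  id P := ⟨OrderHom.id, fun _ p hp => ⟨p, hp, rfl⟩⟩
  comp f g := ⟨g.toOrderHom.comp f.toOrderHom, fun q p hp => by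
    obtain ⟨r, hr, rfl⟩ := g.isOpen (f.toOrderHom q) p hp
    obtain ⟨q', hq', rfl⟩ := f.isOpen q r hr
    exact ⟨q', hq', rfl⟩⟩

/-- The rooted poset `↓p`. -/
def down (P : FinRootedPoset.{u}) (p : P) : FinRootedPoset.{u} where
  carrier := Set.Iic p

/-- The inclusion of `↓p` in `P`, as a monotone map. -/
def downIncl (P : FinRootedPoset.{u}) (p : P) : P.down p →o P :=
  OrderHom.Subtype.val (· ∈ Set.Iic p)

/-- The inclusion of `↓p` in `P`, as an open map. -/
def downHom (P : FinRootedPoset.{u}) (p : P) : P.down p ⟶ P :=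
  Hom.mk (P.downIncl p) fun q r hr =>
    ⟨(⟨r, le_trans hr q.2⟩ : Set.Iic p), hr, rfl⟩

end FinRootedPoset

/-- The preimage map `𝒟(P) → 𝒟(Q)` on downward closed sets induced by an open map `Q → P`. -/
def FinRootedPoset.Hom.preimage {Q P : FinRootedPoset.{u}} (f : FinRootedPoset.Hom Q P) :
    HeytingHom (LowerSet P) (LowerSet Q) where
  toFun s := ⟨f.toOrderHom ⁻¹' s, fun _ _ h hs => s.lower (f.toOrderHom.monotone h) hs⟩
  map_sup' _ _ := rfl
  map_inf' _ _ := rfl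
  map_bot' := rfl
  map_himp' s t := by
    apply le_antisymm
    · rw [le_himp_iff]
      intro q hq
      have h : s ⊓ (s ⇨ t) ≤ t := inf_himp_le
      exact h ⟨hq.2, hq.1⟩
    · intro q hq
      have h : LowerSet.Iic (f.toOrderHom q) ≤ s ⇨ t := by
        rw [le_himp_iff]
        rintro p ⟨hp, hps⟩
        obtain ⟨q', hq', rfl⟩ := f.isOpen q p hp
        have h' := @inf_himp_le _ _
          (⟨f.toOrderHom ⁻¹' s, fun _ _ h hs => s.lower (f.toOrderHom.monotone h) hs⟩ : LowerSet Q)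
          (⟨f.toOrderHom ⁻¹' t, fun _ _ h hs => t.lower (f.toOrderHom.monotone h) hs⟩ : LowerSet Q)
        exact h' ⟨hps, LowerSet.lower _ hq' hq⟩
      exact h (le_refl (f.toOrderHom q))

/-- If `𝒟(P)` is a `V`-algebra then so is `𝒟(↓p)`, being a homomorphic image of it. -/
theorem FinRootedPoset.mem_down {V : HeytingVariety} (P : FinRootedPoset.{u}) (p : P)
    (hP : V.Mem (LowerSet P)) : V.Mem (LowerSet (P.down p)) := by
  refine hP.of_surjective (FinRootedPoset.Hom.preimage (P.downHom p)) fun s => ?_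
  refine ⟨⟨P.downIncl p '' s, ?_⟩, ?_⟩
  · rintro _ b hb ⟨q, hq, rfl⟩
    exact ⟨(⟨b, le_trans hb q.2⟩ : Set.Iic p), s.lower hb hq, rfl⟩
  · apply SetLike.coe_injective
    exact Set.preimage_image_eq _ Subtype.val_injective

/-- The category of finite rooted posets `P` such that `𝒟(P)`, the Heyting algebra of downward
closed subsets of `P`, is a `V`-algebra; arrows are the open maps. -/
abbrev PosetCat (V : HeytingVariety) :=
  ObjectProperty.FullSubcategory (fun P : FinRootedPoset.{u} => V.Mem (LowerSet P))

/-- The object `↓p` of `PosetCat V`. -/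
def PosetCat.down {V : HeytingVariety} (P : PosetCat.{u} V) (p : P.obj) : PosetCat.{u} V :=
  ⟨P.obj.down p, P.obj.mem_down p P.property⟩

/-- The inclusion of `↓p` in `P`, as an arrow of `PosetCat V`. -/
def PosetCat.downHom {V : HeytingVariety} (P : PosetCat.{u} V) (p : P.obj) : P.down p ⟶ P :=
  ObjectProperty.homMk (P.obj.downHom p)

/-! ### Evaluations and bounded bisimulation -/

/-- For an `L`-evaluation `v : P → L` and `p : P`, the evaluation `v_p : ↓p → L`. -/
def evalRestrict {L : Type*} [PartialOrder L] {P : FinRootedPoset.{u}} (v : P →o L) (p : P) :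
    P.down p →o L :=
  v.comp (P.downIncl p)

/-- The bounded bisimulation relations `v ∼ₙ w` between `L`-evaluations: `v ∼₀ w` if `v` and `w`
agree at the roots, and `v ∼ₙ₊₁ w` if the `v_p` and the `w_q` have the same `∼ₙ`-classes. -/
def BddBisim {L : Type*} [PartialOrder L] :
    ℕ → ∀ {P Q : FinRootedPoset.{u}}, (P →o L) → (Q →o L) → Prop
  | 0, _, _, v, w => v ⊤ = w ⊤
  | n + 1, P, Q, v, w =>
    (∀ p : P, ∃ q : Q, BddBisim n (evalRestrict v p) (evalRestrict w q)) ∧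
    (∀ q : Q, ∃ p : P, BddBisim n (evalRestrict v p) (evalRestrict w q))

/-- The evaluation sheaf `h_L` over `PosetCat V`: `h_L(P)` is the set of monotone maps `P → L`, and
open maps act by precomposition. -/
def evalSheaf (V : HeytingVariety) (L : FinPartOrd.{u}) : (PosetCat.{u} V)ᵒᵖ ⥤ Type u where
  obj P := P.unop.obj →o L
  map f := ↾(fun v => v.comp f.unop.hom.toOrderHom)

/-- `n` is a b-index of the natural transformation `ψ : h_L → h_M`: whenever `v ∼ₙ w`, also
`ψ(v) ∼₀ ψ(w)`. -/
def IsBIndex {V : HeytingVariety} {L M : FinPartOrd.{u}} (ψ : evalSheaf V L ⟶ evalSheaf V M)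
    (n : ℕ) : Prop :=
  ∀ (P Q : PosetCat.{u} V) (v : P.obj →o L) (w : Q.obj →o L), BddBisim n v w →
    BddBisim 0 (L := M) (P := P.obj) (Q := Q.obj) (ψ.app (op P) v) (ψ.app (op Q) w)

/-- Natural transformations between evaluation sheaves commute with restriction to `↓p`. -/
theorem evalRestrict_app {V : HeytingVariety} {L M : FinPartOrd.{u}}
    (ψ : evalSheaf V L ⟶ evalSheaf V M) (P : PosetCat.{u} V) (v : P.obj →o L) (p : P.obj) :
    evalRestrict (L := M) (P := P.obj) (ψ.app (op P) v) p =
      ψ.app (op (P.down p)) (evalRestrict v p) :=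
  (NatTrans.naturality_apply ψ (P.downHom p).op v).symm

/-- A natural transformation with b-index `n` sends `∼ₙ₊ₖ` to `∼ₖ`. -/
theorem IsBIndex.bddBisim {V : HeytingVariety} {L M : FinPartOrd.{u}}
    {ψ : evalSheaf V L ⟶ evalSheaf V M} {n : ℕ} (h : IsBIndex ψ n) (k : ℕ) :
    ∀ (P Q : PosetCat.{u} V) (v : P.obj →o L) (w : Q.obj →o L), BddBisim (n + k) v w →
      BddBisim k (L := M) (P := P.obj) (Q := Q.obj) (ψ.app (op P) v) (ψ.app (op Q) w) := by
  induction k with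
  | zero => exact h
  | succ k ih =>
    rintro P Q v w ⟨h₁, h₂⟩
    refine ⟨fun p => ?_, fun q => ?_⟩
    · obtain ⟨q, hq⟩ := h₁ p
      refine ⟨q, ?_⟩
      rw [evalRestrict_app, evalRestrict_app]
      exact ih (P.down p) (Q.down q) _ _ hq
    · obtain ⟨p, hp⟩ := h₂ q
      refine ⟨p, ?_⟩
      rw [evalRestrict_app, evalRestrict_app]
      exact ih (P.down p) (Q.down q) _ _ hp

/-- The objects of the category of evaluation sheaves over `PosetCat V`: there is one evaluation
sheaf `h_L` for each finite poset `L`. -/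
structure EvalSheafCat (V : HeytingVariety) : Type (u + 1) where
  poset : FinPartOrd.{u}

/-- The arrows `h_L → h_M` are the natural transformations that have a b-index. -/
instance (V : HeytingVariety) : Category (EvalSheafCat.{u} V) where
  Hom X Y := { ψ : evalSheaf V X.poset ⟶ evalSheaf V Y.poset // ∃ n, IsBIndex ψ n }
  id X := ⟨𝟙 _, 0, fun _ _ _ _ h => h⟩
  comp f g := ⟨f.1 ≫ g.1, by
    obtain ⟨n, hn⟩ := f.2
    obtain ⟨k, hk⟩ := g.2
    exact ⟨n + k, fun P Q v w h => hk P Q _ _ (hn.bddBisim k P Q v w h)⟩⟩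

/-! Send `h_L` to the Heyting algebra `EvalAlgebra V L` of families of downsets, one in `P` for each
evaluation `v : P → L`, generated by the families `v⁻¹(d)` with `d` a downset of `L`. Two facts
carry the proof.

Its elements are exactly the families in which membership of a point depends only on its
bisimulation type of some bounded depth (`exists_hasIndex`, `exists_val_eq_of_hasIndex`); this rests
on there being finitely many types of each depth.

It is free over `LowerSet L` (`isFreeOver_unit`): by finite approximability, an equation between
generators that fails in some `V`-algebra already fails in some `𝒟(P)`, where the generators are
interpreted by an evaluation `P → L`.

Natural transformations with a b-index then act on families by pullback. Conversely, a homomorphism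
read on the generators at one evaluation is a lattice morphism `𝒟(M) → 𝒟(P)`, that is, a monotone
map `P → M`; bounded depth makes these maps natural and supplies a b-index (`exists_eq_comap`).
Essential surjectivity is Birkhoff's theorem for finite distributive lattices. -/

/-! ### The subalgebra generated by a sequence of elements -/

/-- The Heyting subalgebra of `H` generated by the sequence `x`, placed in any universe. -/
def TermAlgebra {H : Type*} [HeytingAlgebra H] (x : ℕ → H) : Type u :=
  ULift.{u} (Quotient (Setoid.ker (HeytingTerm.eval x)))

namespace TermAlgebra

variable {H : Type*} [HeytingAlgebra H] {x : ℕ → H}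

/-- The element of the generated subalgebra given by a term. -/
def mk (x : ℕ → H) (t : HeytingTerm) : TermAlgebra.{u} x := ⟨Quotient.mk _ t⟩

/-- The underlying element of the ambient algebra. -/
def val (a : TermAlgebra.{u} x) : H := Quotient.lift (HeytingTerm.eval x) (fun _ _ h => h) a.down

theorem val_mk (t : HeytingTerm) : val (mk.{u} x t) = t.eval x := rfl

theorem val_injective : Function.Injective (val : TermAlgebra.{u} x → H) := by
  rintro ⟨⟨s⟩⟩ ⟨⟨t⟩⟩ h
  exact congrArg ULift.up (Quotient.sound h)

theorem exists_mk (a : TermAlgebra.{u} x) : ∃ t, mk x t = a := by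
  obtain ⟨⟨t⟩⟩ := a
  exact ⟨t, rfl⟩

/-- A term representing an element. -/
noncomputable def rep (a : TermAlgebra.{u} x) : HeytingTerm := a.exists_mk.choose

theorem eval_rep (a : TermAlgebra.{u} x) : a.rep.eval x = a.val :=
  congrArg val a.exists_mk.choose_spec

noncomputable instance : Max (TermAlgebra.{u} x) := ⟨fun a b => mk x (.sup a.rep b.rep)⟩
noncomputable instance : Min (TermAlgebra.{u} x) := ⟨fun a b => mk x (.inf a.rep b.rep)⟩
instance : LE (TermAlgebra.{u} x) := ⟨fun a b => a.val ≤ b.val⟩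
instance : LT (TermAlgebra.{u} x) := ⟨fun a b => a.val < b.val⟩
instance : Top (TermAlgebra.{u} x) := ⟨mk x .top⟩
instance : Bot (TermAlgebra.{u} x) := ⟨mk x .bot⟩
noncomputable instance : Compl (TermAlgebra.{u} x) := ⟨fun a => mk x (.imp a.rep .bot)⟩
noncomputable instance : HImp (TermAlgebra.{u} x) := ⟨fun a b => mk x (.imp a.rep b.rep)⟩

theorem val_sup (a b : TermAlgebra.{u} x) : (a ⊔ b).val = a.val ⊔ b.val :=
  congrArg₂ (· ⊔ ·) a.eval_rep b.eval_rep

theorem val_inf (a b : TermAlgebra.{u} x) : (a ⊓ b).val = a.val ⊓ b.val :=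
  congrArg₂ (· ⊓ ·) a.eval_rep b.eval_rep

theorem val_himp (a b : TermAlgebra.{u} x) : (a ⇨ b).val = a.val ⇨ b.val :=
  congrArg₂ (· ⇨ ·) a.eval_rep b.eval_rep

theorem val_compl (a : TermAlgebra.{u} x) : (aᶜ).val = (a.val)ᶜ :=
  (congrArg (· ⇨ ⊥) a.eval_rep).trans (himp_bot _)

noncomputable instance : HeytingAlgebra (TermAlgebra.{u} x) :=
  val_injective.heytingAlgebra val Iff.rfl Iff.rfl val_sup val_inf rfl rfl val_compl val_himp

/-- The inclusion of the generated subalgebra. -/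
def incl (x : ℕ → H) : HeytingHom (TermAlgebra.{u} x) H where
  toFun := val
  map_sup' := val_sup
  map_inf' := val_inf
  map_bot' := rfl
  map_himp' := val_himp

theorem incl_apply (a : TermAlgebra.{u} x) : incl x a = a.val := rfl

/-- The generators. -/
def gen (x : ℕ → H) (i : ℕ) : TermAlgebra.{u} x := mk x (.var i)

theorem mk_eq_eval (t : HeytingTerm) : mk.{u} x t = t.eval (gen x) :=
  val_injective (HeytingTerm.map_eval (incl x) (gen x) t).symm

theorem mem_of_mem {V : HeytingVariety} (hH : V.Mem H) : V.Mem (TermAlgebra.{u} x) := by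
  intro e he y
  apply val_injective
  have := hH e he fun i => (y i).val
  rw [← incl_apply, ← incl_apply, HeytingTerm.map_eval, HeytingTerm.map_eval]
  exact this

theorem hom_ext {B : Type*} [HeytingAlgebra B] {φ ψ : HeytingHom (TermAlgebra.{u} x) B}
    (h : ∀ i, φ (gen x i) = ψ (gen x i)) : φ = ψ := by
  ext a
  obtain ⟨t, rfl⟩ := a.exists_mk
  rw [mk_eq_eval, HeytingTerm.map_eval, HeytingTerm.map_eval]
  simp only [h]

/-- A homomorphism on the generated subalgebra is given by the images of the generators, if these
satisfy all equations between the generators. -/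
theorem exists_lift {B : Type*} [HeytingAlgebra B] (y : ℕ → B)
    (h : ∀ s t : HeytingTerm, s.eval x = t.eval x → s.eval y = t.eval y) :
    ∃ φ : HeytingHom (TermAlgebra.{u} x) B, ∀ i, φ (gen x i) = y i := by
  have key : ∀ (a : TermAlgebra.{u} x) (t : HeytingTerm), a.val = t.eval x →
      a.rep.eval y = t.eval y := fun a t ht => h _ _ (a.eval_rep.trans ht)
  refine ⟨{ toFun := fun a => a.rep.eval y
            map_sup' := fun a b => key _ (.sup a.rep b.rep) rfl
            map_inf' := fun a b => key _ (.inf a.rep b.rep) rfl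
            map_bot' := key _ .bot rfl
            map_himp' := fun a b => key _ (.imp a.rep b.rep) rfl }, fun i => key _ (.var i) rfl⟩

end TermAlgebra

/-! ### Products and finitely generated free algebras -/

theorem HeytingTerm.eval_pi {ι : Type*} {B : ι → Type*} [∀ i, HeytingAlgebra (B i)]
    (y : ℕ → ∀ i, B i) (i : ι) (t : HeytingTerm) : t.eval y i = t.eval fun j => y j i := by
  induction t with
  | var j => rfl
  | bot => rfl
  | top => rfl
  | inf s t hs ht => exact congrArg₂ (· ⊓ ·) hs ht
  | sup s t hs ht => exact congrArg₂ (· ⊔ ·) hs ht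
  | imp s t hs ht => exact congrArg₂ (· ⇨ ·) hs ht

theorem HeytingVariety.mem_pi {V : HeytingVariety} {ι : Type*} {B : ι → Type*}
    [∀ i, HeytingAlgebra (B i)] (h : ∀ i, V.Mem (B i)) : V.Mem (∀ i, B i) := by
  intro e he y
  funext i
  rw [HeytingTerm.eval_pi, HeytingTerm.eval_pi]
  exact h i e he _

/-- Free finitely generated algebras exist. -/
theorem HeytingVariety.exists_isFreeOn (V : HeytingVariety) (n : ℕ) :
    ∃ (F : Type u) (_ : HeytingAlgebra F) (η : Fin n → F), V.IsFreeOn η := by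
  -- The generic tuple, in the product over all `V`-algebras `B` and all `n`-tuples of `B`. Terms
  -- have infinitely many variables, so it is padded with `⊥`, which enlarges no subalgebra.
  let z : ℕ → ∀ (B : { B : HeytAlg.{u} // V.Mem B }) (_ : Fin n → B.1), B.1 :=
    fun i B y => if h : i < n then y ⟨i, h⟩ else ⊥
  refine ⟨TermAlgebra.{u} z, inferInstance, fun i => TermAlgebra.gen z i, ?_, ?_⟩
  · exact TermAlgebra.mem_of_mem (V.mem_pi fun B => V.mem_pi fun y => B.2)
  · intro B _ hB g
    obtain ⟨φ, hφ⟩ := TermAlgebra.exists_lift.{u} (x := z)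
      (fun i => z i ⟨HeytAlg.of B, hB⟩ g) fun s t h => by
        rw [← HeytingTerm.eval_pi (fun i => z i ⟨HeytAlg.of B, hB⟩),
          ← HeytingTerm.eval_pi (fun i => z i ⟨HeytAlg.of B, hB⟩), ← HeytingTerm.eval_pi z,
          ← HeytingTerm.eval_pi z, h]
    refine ⟨φ, fun i => (hφ i).trans (dif_pos i.2), fun ψ hψ => TermAlgebra.hom_ext fun i => ?_⟩
    by_cases hi : i < n
    · exact (hψ ⟨i, hi⟩).trans ((hφ i).trans (dif_pos hi)).symm
    · have : TermAlgebra.gen.{u} z i = ⊥ := TermAlgebra.val_injective <| by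
        funext B y
        exact dif_neg hi
      rw [this, map_bot, map_bot]

/-! ### Bisimulation types -/

theorem LowerSet.mem_himp_iff {α : Type*} [PartialOrder α] {s t : LowerSet α} {p : α} :
    p ∈ s ⇨ t ↔ ∀ r ≤ p, r ∈ s → r ∈ t := by
  rw [← LowerSet.Iic_le, le_himp_iff]
  exact ⟨fun h r hr hs => h ⟨hr, hs⟩, fun h r hr => h r hr.1 hr.2⟩

/-- The finite poset of types of points up to bisimulation of depth `n`. -/
noncomputable def BisimType (L : FinPartOrd.{u}) : ℕ → FinPartOrd.{u}
  | 0 => L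
  -- Ordered by inclusion; the sets need not be realised by any evaluation.
  | n + 1 => haveI := Classical.decEq (BisimType L n); FinPartOrd.of (Set (BisimType L n))

/-- The type of the point `p` under the evaluation `v` up to bisimulation of depth `n`. -/
def bisimType {L : FinPartOrd.{u}} {P : Type u} [PartialOrder P] (v : P →o L) :
    ∀ n, P →o BisimType L n
  | 0 => v
  | n + 1 =>
    { toFun := fun p => (bisimType v n '' Set.Iic p : Set (BisimType L n))
      monotone' := fun _ _ h => Set.image_mono (Set.Iic_subset_Iic.2 h) }

theorem bisimType_succ {L : FinPartOrd.{u}} {P : Type u} [PartialOrder P] (v : P →o L) (n : ℕ)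
    (p : P) : bisimType v (n + 1) p = (bisimType v n '' Set.Iic p : Set (BisimType L n)) := rfl

/-- An open map sends `↓q` onto `↓f(q)`, so both points see the same types one level down. -/
theorem bisimType_comp {L : FinPartOrd.{u}} {P Q : FinRootedPoset.{u}} (v : P →o L)
    (f : FinRootedPoset.Hom Q P) (n : ℕ) (q : Q) :
    bisimType (v.comp f.toOrderHom) n q = bisimType v n (f.toOrderHom q) := by
  induction n generalizing q with
  | zero => rfl
  | succ n ih =>
    apply Set.ext
    intro t
    constructor
    · rintro ⟨q', hq', rfl⟩
      exact ⟨f.toOrderHom q', f.toOrderHom.monotone hq', (ih q').symm⟩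
    · rintro ⟨p, hp, rfl⟩
      obtain ⟨q', hq', rfl⟩ := f.isOpen q p hp
      exact ⟨q', hq', ih q'⟩

theorem bisimType_evalRestrict {L : FinPartOrd.{u}} {P : FinRootedPoset.{u}} (v : P →o L) (p : P)
    (n : ℕ) : bisimType (evalRestrict v p) n ⊤ = bisimType v n p :=
  bisimType_comp v (P.downHom p) n ⊤

/-- Turns a relation between different evaluations into equality in one finite poset. -/
theorem bddBisim_iff {L : FinPartOrd.{u}} (n : ℕ) {P Q : FinRootedPoset.{u}} (v : P →o L)
    (w : Q →o L) : BddBisim n v w ↔ bisimType v n ⊤ = bisimType w n ⊤ := by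
  induction n generalizing P Q with
  | zero => rfl
  | succ n ih =>
    have h : BddBisim (n + 1) v w ↔
      (∀ p, ∃ q, bisimType v n p = bisimType w n q) ∧
      (∀ q, ∃ p, bisimType v n p = bisimType w n q) := by
      simp only [BddBisim, ih, bisimType_evalRestrict]
    rw [h, bisimType_succ, bisimType_succ]
    simp only [Set.Iic_top, Set.image_univ]
    refine ⟨fun h => Set.ext fun t => ⟨?_, ?_⟩, fun h => ⟨fun p => ?_, fun q => ?_⟩⟩
    · rintro ⟨p, rfl⟩
      exact (h.1 p).imp fun q hq => hq.symm
    · rintro ⟨q, rfl⟩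
      exact h.2 q
    · have : bisimType v n p ∈ Set.range (bisimType w n) := h ▸ Set.mem_range_self p
      exact this.imp fun q hq => hq.symm
    · have : bisimType w n q ∈ Set.range (bisimType v n) := h ▸ Set.mem_range_self q
      exact this

/-- The depth-`n` type of a point is recovered as the greatest element of its depth-`n + 1` type,
since `p` is greatest in `↓p`. -/
theorem bisimType_eq_of_succ {L : FinPartOrd.{u}} {n : ℕ} {P Q : FinRootedPoset.{u}} {v : P →o L}
    {w : Q →o L} {p : P} {q : Q} (h : bisimType v (n + 1) p = bisimType w (n + 1) q) :
    bisimType v n p = bisimType w n q := by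
  have h' : bisimType v n '' Set.Iic p = bisimType w n '' Set.Iic q := h
  have hv : IsGreatest (bisimType v n '' Set.Iic p) (bisimType v n p) :=
    (bisimType v n).monotone.map_isGreatest isGreatest_Iic
  have hw : IsGreatest (bisimType w n '' Set.Iic q) (bisimType w n q) :=
    (bisimType w n).monotone.map_isGreatest isGreatest_Iic
  rw [h'] at hv
  exact hv.unique hw

theorem bisimType_eq_of_le {L : FinPartOrd.{u}} {m n : ℕ} (hmn : m ≤ n)
    {P Q : FinRootedPoset.{u}} {v : P →o L} {w : Q →o L} {p : P} {q : Q}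
    (h : bisimType v n p = bisimType w n q) : bisimType v m p = bisimType w m q := by
  induction n, hmn using Nat.le_induction with
  | base => exact h
  | succ n _ ih => exact ih (bisimType_eq_of_succ h)

/-! ### The algebra of an evaluation sheaf -/

/-- Families of lower sets, one for each evaluation over `PosetCat V`. -/
abbrev EvalFamily (V : HeytingVariety) (L : FinPartOrd.{u}) :=
  ∀ (P : PosetCat.{u} V) (_ : P.obj →o L), LowerSet P.obj

theorem EvalFamily.mem (V : HeytingVariety) (L : FinPartOrd.{u}) : V.Mem (EvalFamily V L) :=
  V.mem_pi fun P => V.mem_pi fun _ => P.property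

/-- Membership in the family `S` depends only on bisimulation types of depth `n`. -/
def EvalFamily.HasIndex {V : HeytingVariety} {L : FinPartOrd.{u}} (S : EvalFamily V L) (n : ℕ) :
    Prop :=
  ∀ (P Q : PosetCat.{u} V) (v : P.obj →o L) (w : Q.obj →o L) (p : P.obj) (q : Q.obj),
    bisimType v n p = bisimType w n q → p ∈ S P v → q ∈ S Q w

namespace EvalFamily

variable {V : HeytingVariety} {L : FinPartOrd.{u}}

theorem HasIndex.mono {S : EvalFamily V L} {m n : ℕ} (h : S.HasIndex m) (hmn : m ≤ n) :
    S.HasIndex n :=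
  fun P Q v w p q hpq => h P Q v w p q (bisimType_eq_of_le hmn hpq)

/-- Membership in an implication quantifies over the points below, whose depth-`n` types are what
the depth-`n + 1` type records. -/
theorem HasIndex.himp {S T : EvalFamily V L} {n : ℕ} (hS : S.HasIndex n) (hT : T.HasIndex n) :
    (S ⇨ T).HasIndex (n + 1) := by
  intro P Q v w p q h hp
  change q ∈ S Q w ⇨ T Q w
  replace hp : p ∈ S P v ⇨ T P v := hp
  rw [LowerSet.mem_himp_iff] at hp ⊢
  intro r hr hrS
  have h' : bisimType v n '' Set.Iic p = bisimType w n '' Set.Iic q := h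
  have : bisimType w n r ∈ bisimType v n '' Set.Iic p := h' ▸ Set.mem_image_of_mem _ hr
  obtain ⟨r', hr', e⟩ := this
  exact hT _ _ _ _ _ _ e (hp r' hr' (hS _ _ _ _ _ _ e.symm hrS))

/-- The family of the points whose value belongs to a given lower set. -/
def ofLowerSet (V : HeytingVariety) (L : FinPartOrd.{u}) (d : LowerSet L) : EvalFamily V L :=
  fun _ v => ⟨v ⁻¹' d, fun _ _ h hs => d.lower (v.monotone h) hs⟩

/-- An enumeration of the lower sets of a finite poset. -/
noncomputable def lowerSetSeq (L : FinPartOrd.{u}) : ℕ → LowerSet L :=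
  haveI : Finite (LowerSet L) := Finite.of_injective _ SetLike.coe_injective
  (exists_surjective_nat (LowerSet L)).choose

theorem lowerSetSeq_surjective (L : FinPartOrd.{u}) : Function.Surjective (lowerSetSeq L) :=
  haveI : Finite (LowerSet L) := Finite.of_injective _ SetLike.coe_injective
  (exists_surjective_nat (LowerSet L)).choose_spec

/-- The family of the points whose type lies below `t`. -/
def below (V : HeytingVariety) {n : ℕ} (t : BisimType L n) : EvalFamily V L :=
  fun _ v => ⟨{p | bisimType v n p ≤ t}, fun _ _ h hs => ((bisimType v n).monotone h).trans hs⟩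

theorem mem_below {n : ℕ} {t : BisimType L n} {P : PosetCat.{u} V} {v : P.obj →o L} {p : P.obj} :
    p ∈ below V t P v ↔ bisimType v n p ≤ t := Iff.rfl

/-- The sequence of generators of the algebra of the evaluation sheaf. -/
noncomputable def genSeq (V : HeytingVariety) (L : FinPartOrd.{u}) (i : ℕ) : EvalFamily V L :=
  ofLowerSet V L (lowerSetSeq L i)

end EvalFamily

open EvalFamily

/-- The Heyting algebra of an evaluation sheaf. -/
abbrev EvalAlgebra (V : HeytingVariety) (L : FinPartOrd.{u}) : Type u :=
  TermAlgebra.{u} (genSeq V L)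

/-! ### Elements of the algebra are the families with an index -/

namespace EvalAlgebra

variable {V : HeytingVariety} {L : FinPartOrd.{u}}

theorem exists_hasIndex (a : EvalAlgebra V L) : ∃ n, a.val.HasIndex n := by
  obtain ⟨t, rfl⟩ := a.exists_mk
  rw [TermAlgebra.val_mk]
  induction t with
  | var i =>
    refine ⟨0, fun P Q v w p q h hp => ?_⟩
    have h : v p = w q := h
    change w q ∈ lowerSetSeq L i
    exact h ▸ hp
  | bot => exact ⟨0, fun _ _ _ _ _ _ _ h => h⟩
  | top => exact ⟨0, fun _ _ _ _ _ _ _ _ => trivial⟩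
  | inf s t hs ht =>
    obtain ⟨m, hm⟩ := hs
    obtain ⟨n, hn⟩ := ht
    exact ⟨max m n, fun P Q v w p q e h =>
      ⟨hm.mono (le_max_left m n) P Q v w p q e h.1, hn.mono (le_max_right m n) P Q v w p q e h.2⟩⟩
  | sup s t hs ht =>
    obtain ⟨m, hm⟩ := hs
    obtain ⟨n, hn⟩ := ht
    exact ⟨max m n, fun P Q v w p q e h =>
      h.imp (hm.mono (le_max_left m n) P Q v w p q e) (hn.mono (le_max_right m n) P Q v w p q e)⟩
  | imp s t hs ht =>
    obtain ⟨m, hm⟩ := hs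
    obtain ⟨n, hn⟩ := ht
    exact ⟨max m n + 1, (hm.mono (le_max_left m n)).himp (hn.mono (le_max_right m n))⟩

theorem exists_val_eq_ofLowerSet (d : LowerSet L) :
    ∃ a : EvalAlgebra V L, a.val = ofLowerSet V L d := by
  obtain ⟨i, rfl⟩ := lowerSetSeq_surjective L d
  exact ⟨TermAlgebra.gen _ i, rfl⟩

theorem exists_val_eq_sup {ι : Type*} [Finite ι] (S : ι → EvalFamily V L)
    (h : ∀ i, ∃ a : EvalAlgebra V L, a.val = S i) (s : Set ι) :
    ∃ a : EvalAlgebra V L, ∀ P v p, p ∈ a.val P v ↔ ∃ i ∈ s, p ∈ S i P v := by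
  choose a ha using h
  induction s, s.toFinite using Set.Finite.induction_on with
  | empty => exact ⟨⊥, fun P v p => ⟨fun h => h.elim, fun ⟨i, hi, _⟩ => hi.elim⟩⟩
  | @insert i s _ _ ih =>
    obtain ⟨b, hb⟩ := ih
    refine ⟨a i ⊔ b, fun P v p => ?_⟩
    rw [TermAlgebra.val_sup, ha]
    change p ∈ S i P v ∨ p ∈ b.val P v ↔ _
    simp [hb]

theorem exists_val_eq_inf {ι : Type*} [Finite ι] (S : ι → EvalFamily V L)
    (h : ∀ i, ∃ a : EvalAlgebra V L, a.val = S i) (s : Set ι) :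
    ∃ a : EvalAlgebra V L, ∀ P v p, p ∈ a.val P v ↔ ∀ i ∈ s, p ∈ S i P v := by
  choose a ha using h
  induction s, s.toFinite using Set.Finite.induction_on with
  | empty => exact ⟨⊤, fun P v p => ⟨fun _ _ h => h.elim, fun _ => trivial⟩⟩
  | @insert i s _ _ ih =>
    obtain ⟨b, hb⟩ := ih
    refine ⟨a i ⊓ b, fun P v p => ?_⟩
    rw [TermAlgebra.val_inf, ha]
    change p ∈ S i P v ∧ p ∈ b.val P v ↔ _
    simp [hb]

/-- Characteristic formulas, by induction on depth. A point lies below the set `t` iff no type `s ∉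
t` occurs beneath it, and `s` is avoided beneath it exactly when "below `s`" implies "below some `s'
< s`". -/
theorem exists_val_eq_below {n : ℕ} (t : BisimType L n) :
    ∃ a : EvalAlgebra V L, a.val = below V t := by
  induction n with
  | zero => exact exists_val_eq_ofLowerSet (LowerSet.Iic (α := L) t)
  | succ n ih =>
    let t' : Set (BisimType L n) := t
    choose c hc using fun s : BisimType L n => exists_val_eq_sup _ ih {s' | s' < s}
    choose b hb using ih
    obtain ⟨a, ha⟩ := exists_val_eq_inf (fun s : BisimType L n => (b s ⇨ c s).val)
      (fun s => ⟨_, rfl⟩) {s | s ∉ t'}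
    refine ⟨a, ?_⟩
    funext P v
    ext p
    change p ∈ a.val P v ↔ bisimType v n '' Set.Iic p ⊆ t'
    rw [ha]
    have key : ∀ s : BisimType L n, p ∈ (b s ⇨ c s).val P v ↔ ∀ r ≤ p, bisimType v n r ≠ s := by
      intro s
      rw [TermAlgebra.val_himp, hb]
      change p ∈ below V s P v ⇨ (c s).val P v ↔ _
      rw [LowerSet.mem_himp_iff]
      simp only [hc, mem_below]
      constructor
      · intro h r hr e
        obtain ⟨s', hs', hle⟩ := h r hr e.le
        exact absurd (e ▸ hle) (not_le_of_gt hs')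
      · exact fun h r hr hle => ⟨_, lt_of_le_of_ne hle (h r hr), le_rfl⟩
    simp only [key]
    constructor
    · rintro h _ ⟨r, hr, rfl⟩
      by_contra hn
      exact h _ hn r hr rfl
    · intro h s hs r hr e
      exact hs (e ▸ h ⟨r, hr, rfl⟩)

/-- The family is the finite union of the families below the types it realises. Depth `n + 1` is
needed: inclusion there provides a point under `q` with the same depth-`n` type as `p`, which mere
comparability at depth `n` would not. -/
theorem exists_val_eq_of_hasIndex {S : EvalFamily V L} {n : ℕ} (h : S.HasIndex n) :
    ∃ a : EvalAlgebra V L, a.val = S := by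
  obtain ⟨a, ha⟩ := exists_val_eq_sup (V := V) (fun t : BisimType L (n + 1) => below V t)
    exists_val_eq_below {t | ∃ (Q : PosetCat.{u} V) (w : Q.obj →o L) (q : Q.obj),
      q ∈ S Q w ∧ bisimType w (n + 1) q = t}
  refine ⟨a, ?_⟩
  funext P v
  ext p
  change p ∈ a.val P v ↔ p ∈ S P v
  rw [ha]
  constructor
  · rintro ⟨_, ⟨Q, w, q, hq, rfl⟩, hp⟩
    have hp : bisimType v n '' Set.Iic p ⊆ bisimType w n '' Set.Iic q := hp
    obtain ⟨r, hr, e⟩ := hp (Set.mem_image_of_mem _ (Set.self_mem_Iic))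
    exact h _ _ _ _ _ _ e ((S Q w).lower hr hq)
  · exact fun hp => ⟨_, ⟨P, v, p, hp, rfl⟩, mem_below.2 le_rfl⟩

end EvalAlgebra

open scoped symmDiff

/-! ### Finite duality -/

/-- Bounded lattice morphisms between lattices of lower sets are preimages under monotone maps. -/
theorem BoundedLatticeHom.exists_orderHom {L P : Type*} [PartialOrder L] [Finite L]
    [PartialOrder P] (G : BoundedLatticeHom (LowerSet L) (LowerSet P)) :
    ∃ v : P →o L, ∀ d p, p ∈ G d ↔ v p ∈ d := by
  have : Finite (LowerSet L) := Finite.of_injective _ SetLike.coe_injective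
  have point : ∀ p, ∃ l, ∀ d, p ∈ G d ↔ l ∈ d := by
    intro p
    -- The downsets `d` with `p ∈ G d` form a prime filter; its least element is join-irreducible,
    -- hence principal, and its generator is the value at `p`.
    obtain ⟨d, hd⟩ := Set.Finite.exists_minimal (s := {d | p ∈ G d}) (Set.toFinite _)
      ⟨⊤, by simp⟩
    have hle : ∀ b, p ∈ G b → d ≤ b := fun b hb => by
      have h : p ∈ G (d ⊓ b) := by
        rw [map_inf]
        exact ⟨hd.1, hb⟩
      exact (hd.2 h inf_le_left).trans inf_le_right
    have hirr : SupIrred d := by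
      refine ⟨fun hmin => ?_, fun b c hbc => ?_⟩
      · have h := hd.1
        rw [hmin.eq_bot, Set.mem_ofPred_eq, map_bot] at h
        exact h
      · have h := hd.1
        rw [← hbc, Set.mem_ofPred_eq, map_sup] at h
        rcases h with h | h
        · exact Or.inl (le_antisymm (hbc ▸ le_sup_left) (hle b h))
        · exact Or.inr (le_antisymm (hbc ▸ le_sup_right) (hle c h))
    obtain ⟨l, rfl⟩ := LowerSet.supIrred_iff_of_finite.1 hirr
    refine ⟨l, fun b => ⟨fun h => LowerSet.Iic_le.1 (hle b h), fun h => ?_⟩⟩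
    exact OrderHomClass.mono G (LowerSet.Iic_le.2 h) hd.1
  choose v hv using point
  refine ⟨⟨v, fun p q hpq => ?_⟩, fun d p => hv p d⟩
  exact (hv p (LowerSet.Iic (v q))).1
    ((G (LowerSet.Iic (v q))).lower hpq ((hv q (LowerSet.Iic (v q))).2 le_rfl))

/-- Restriction of lower sets to `↓q`. -/
def LowerSet.restrictIic {Q : Type*} [PartialOrder Q] (q : Q) :
    HeytingHom (LowerSet Q) (LowerSet (Set.Iic q)) where
  toFun s := ⟨Subtype.val ⁻¹' s, fun _ _ h hs => s.lower h hs⟩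
  map_sup' _ _ := rfl
  map_inf' _ _ := rfl
  map_bot' := rfl
  map_himp' s t := by
    ext p
    change p.1 ∈ s ⇨ t ↔ p ∈ (⟨Subtype.val ⁻¹' s, fun _ _ h hs => s.lower h hs⟩ :
      LowerSet (Set.Iic q)) ⇨ ⟨Subtype.val ⁻¹' t, fun _ _ h hs => t.lower h hs⟩
    rw [LowerSet.mem_himp_iff, LowerSet.mem_himp_iff]
    exact ⟨fun h r hr => h r.1 hr, fun h r hr => h ⟨r, hr.trans p.2⟩ hr⟩

theorem LowerSet.restrictIic_surjective {Q : Type*} [PartialOrder Q] (q : Q) :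
    Function.Surjective (LowerSet.restrictIic q) := by
  intro s
  refine ⟨⟨Subtype.val '' (s : Set (Set.Iic q)), ?_⟩, ?_⟩
  · rintro _ b hb ⟨r, hr, rfl⟩
    exact ⟨⟨b, hb.trans r.2⟩, s.lower hb hr, rfl⟩
  · apply SetLike.coe_injective
    exact Set.preimage_image_eq _ Subtype.val_injective

/-- In a finite `V`-algebra, elements can be separated by finite rooted posets. -/
theorem HeytingVariety.Mem.exists_posetCat {V : HeytingVariety} {C : Type u} [HeytingAlgebra C]
    [Finite C] (hC : V.Mem C) {a b : C} (hab : ¬ a ≤ b) :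
    ∃ (P : PosetCat.{u} V) (r : HeytingHom C (LowerSet P.obj)), r a = ⊤ ∧ r b ≠ ⊤ := by
  classical
  have := Fintype.ofFinite C
  -- By Birkhoff, `C` is the algebra of downsets of its join-irreducibles. A point `j` in `K a` but
  -- not in `K b` separates them, and restricting to `↓j` gives a rooted poset.
  let K : C ≃o LowerSet {a : C // SupIrred a} := OrderIso.lowerSetSupIrred
  have hK : ¬ K a ≤ K b := fun h => hab (K.le_iff_le.1 h)
  obtain ⟨j, hja, hjb⟩ := Set.not_subset.1 hK
  let r : HeytingHom C (LowerSet (Set.Iic j)) :=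
    (LowerSet.restrictIic j).comp (K : HeytingHom C (LowerSet {a : C // SupIrred a}))
  have hr : Function.Surjective r := (LowerSet.restrictIic_surjective j).comp K.surjective
  refine ⟨⟨⟨Set.Iic j⟩, hC.of_surjective r hr⟩, r, ?_, ?_⟩
  · exact top_le_iff.1 fun i _ => (K a).lower i.2 hja
  · intro h
    have : (⟨j, le_rfl⟩ : Set.Iic j) ∈ r b := h ▸ trivial
    exact hjb this

/-- That a map from a finite bounded lattice is a bounded lattice morphism is expressed by a single
element of a Heyting algebra. -/
theorem exists_diagram {D F : Type*} [DistribLattice D] [BoundedOrder D] [Finite D]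
    [HeytingAlgebra F] (e : D → F) : ∃ θ : F, ∀ {C : Type u} [HeytingAlgebra C]
      (k : HeytingHom F C), k θ = ⊤ ↔ ∃ G : BoundedLatticeHom D C, ∀ d, G d = k (e d) := by
  have := Fintype.ofFinite D
  -- The finite meet of the biimplications stating that `e` preserves each join, each meet and the
  -- bounds.
  refine ⟨(Finset.univ : Finset (D × D)).inf (fun x =>
    (e (x.1 ⊔ x.2) ⇔ (e x.1 ⊔ e x.2)) ⊓ (e (x.1 ⊓ x.2) ⇔ (e x.1 ⊓ e x.2))) ⊓
    ((e ⊤ ⇔ ⊤) ⊓ (e ⊥ ⇔ ⊥)), fun k => ?_⟩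
  simp only [map_inf, map_finset_inf, inf_eq_top_iff, Finset.inf_eq_top_iff, Function.comp_apply,
    map_bihimp, bihimp_eq_top, map_sup, map_top, map_bot, Finset.mem_univ, true_implies]
  constructor
  · rintro ⟨h, ht, hb⟩
    exact ⟨{ toFun := fun d => k (e d)
             map_sup' := fun a b => (h (a, b)).1
             map_inf' := fun a b => (h (a, b)).2
             map_top' := ht
             map_bot' := hb }, fun _ => rfl⟩
  · rintro ⟨G, hG⟩
    simp only [← hG, map_sup, map_inf, map_top, map_bot, and_self, implies_true]

/-! ### Freeness of the algebra of an evaluation sheaf -/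

namespace EvalAlgebra

variable {V : HeytingVariety} {L : FinPartOrd.{u}}

theorem eval_genSeq_apply (t : HeytingTerm) (P : PosetCat.{u} V) (v : P.obj →o L) :
    t.eval (genSeq V L) P v = t.eval fun i => ofLowerSet V L (lowerSetSeq L i) P v := by
  rw [HeytingTerm.eval_pi, HeytingTerm.eval_pi]
  rfl

/-- Equations that hold in all evaluations hold in all `V`-algebras, if `V` is finitely
approximable. -/
theorem eval_eq_of_eval_genSeq_eq (hV : HeytingVariety.FinitelyApproximable.{u} V) {B : Type u}
    [HeytingAlgebra B] (hB : V.Mem B) (g : BoundedLatticeHom (LowerSet L) B) (s t : HeytingTerm)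
    (h : s.eval (genSeq V L) = t.eval (genSeq V L)) :
    s.eval (fun i => g (lowerSetSeq L i)) = t.eval fun i => g (lowerSetSeq L i) := by
  have : Finite (LowerSet L) := Finite.of_injective _ SetLike.coe_injective
  by_contra hne
  let ε := Finite.equivFin (LowerSet L)
  -- Finite approximability concerns algebras free on a set, so `F` is free on the underlying set of
  -- `LowerSet L`. The lattice relations are encoded by `θ` and the equation by `S`; the morphism
  -- `g` witnesses that `θ ≤ S` fails.
  obtain ⟨F, _, η, hF⟩ := V.exists_isFreeOn.{u} (Nat.card (LowerSet L))
  let e : LowerSet L → F := fun d => η (ε d)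
  obtain ⟨θ, hθ⟩ := exists_diagram.{u} e
  let S : F := s.eval (fun i => e (lowerSetSeq L i)) ⇔ t.eval fun i => e (lowerSetSeq L i)
  have hS : ∀ {C : Type u} [HeytingAlgebra C] (k : HeytingHom F C), k S = ⊤ ↔
      s.eval (fun i => k (e (lowerSetSeq L i))) = t.eval fun i => k (e (lowerSetSeq L i)) := by
    intro C _ k
    rw [map_bihimp, bihimp_eq_top, HeytingTerm.map_eval, HeytingTerm.map_eval]
  have hθS : ¬ θ ≤ S := by
    intro hle
    obtain ⟨k, hk, -⟩ := hF.2 B hB fun i => g (ε.symm i)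
    have hk' : ∀ d, k (e d) = g d := fun d => by rw [hk, ε.symm_apply_apply]
    have h₁ : k θ = ⊤ := (hθ k).2 ⟨g, fun d => (hk' d).symm⟩
    have h₂ : k S = ⊤ := top_le_iff.1 (h₁ ▸ OrderHomClass.mono k hle)
    rw [hS] at h₂
    simp only [hk'] at h₂
    exact hne h₂
  obtain ⟨ι, C, hC, φ, hφ⟩ := hV _ F η hF
  have hi : ∃ i, ¬ φ θ i ≤ φ S i := by
    by_contra! hle
    refine hθS (inf_eq_left.1 (hφ ?_))
    rw [map_inf]
    exact inf_eq_left.2 hle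
  obtain ⟨i, hi⟩ := hi
  have := (hC i).1
  obtain ⟨P, r, hrθ, hrS⟩ := (hC i).2.exists_posetCat hi
  let k : HeytingHom F (LowerSet P.obj) :=
    r.comp (HeytingHom.comp
      { toFun := fun x => x i
        map_sup' := fun _ _ => rfl
        map_inf' := fun _ _ => rfl
        map_bot' := rfl
        map_himp' := fun _ _ => rfl } φ)
  -- As `θ` holds in `𝒟(P)`, the generators form a lattice morphism there, so they come from an
  -- evaluation `v`; the equation `h` read at `v` contradicts the failure of `S`.
  obtain ⟨G, hG⟩ := (hθ k).1 hrθ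
  obtain ⟨v, hv⟩ := G.exists_orderHom
  have hkv : ∀ d, k (e d) = ofLowerSet V L d P v := fun d => by
    rw [← hG]
    ext p
    exact hv d p
  refine hrS ((hS k).2 ?_)
  simp only [hkv]
  rw [← eval_genSeq_apply, ← eval_genSeq_apply, h]

/-- The inclusion of the generating distributive lattice. -/
noncomputable def unit (V : HeytingVariety) (L : FinPartOrd.{u}) :
    BoundedLatticeHom (LowerSet L) (EvalAlgebra V L) where
  toFun d := (exists_val_eq_ofLowerSet d).choose
  map_sup' a b := TermAlgebra.val_injective <| by
    simp only [TermAlgebra.val_sup, (exists_val_eq_ofLowerSet _).choose_spec]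
    rfl
  map_inf' a b := TermAlgebra.val_injective <| by
    simp only [TermAlgebra.val_inf, (exists_val_eq_ofLowerSet _).choose_spec]
    rfl
  map_top' := TermAlgebra.val_injective (exists_val_eq_ofLowerSet _).choose_spec
  map_bot' := TermAlgebra.val_injective (exists_val_eq_ofLowerSet _).choose_spec

theorem val_unit (d : LowerSet L) : (unit V L d).val = ofLowerSet V L d :=
  (exists_val_eq_ofLowerSet d).choose_spec

theorem unit_lowerSetSeq (i : ℕ) : unit V L (lowerSetSeq L i) = TermAlgebra.gen (genSeq V L) i :=
  TermAlgebra.val_injective (val_unit _)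

theorem hom_ext {B : Type*} [HeytingAlgebra B] {φ ψ : HeytingHom (EvalAlgebra V L) B}
    (h : ∀ d, φ (unit V L d) = ψ (unit V L d)) : φ = ψ :=
  TermAlgebra.hom_ext fun i => by rw [← unit_lowerSetSeq, h]

/-- Finite approximability is needed only for the existence of extensions; uniqueness is generation.
-/
theorem isFreeOver_unit (hV : HeytingVariety.FinitelyApproximable.{u} V) (L : FinPartOrd.{u}) :
    V.IsFreeOver (unit V L) := by
  refine ⟨TermAlgebra.mem_of_mem (EvalFamily.mem V L), fun B _ hB g => ?_⟩
  obtain ⟨φ, hφ⟩ := TermAlgebra.exists_lift.{u} (x := genSeq V L) (fun i => g (lowerSetSeq L i))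
    (eval_eq_of_eval_genSeq_eq hV hB g)
  have hφ' : ∀ d, φ (unit V L d) = g d := by
    intro d
    obtain ⟨i, rfl⟩ := lowerSetSeq_surjective L d
    rw [unit_lowerSetSeq, hφ]
  exact ⟨φ, hφ', fun ψ hψ => hom_ext fun d => (hψ d).trans (hφ' d).symm⟩

end EvalAlgebra

/-! ### The duality -/

/-- The component of a natural transformation between evaluation sheaves. -/
def evalSheafApp {V : HeytingVariety} {L M : FinPartOrd.{u}} (ψ : evalSheaf V L ⟶ evalSheaf V M)
    {P : PosetCat.{u} V} (v : P.obj →o L) : P.obj →o M :=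
  ψ.app (op P) v

/-- A b-index controls values at roots only; applying it to restrictions to `↓p` controls every
point, at the cost of `n` levels of depth. -/
theorem EvalFamily.HasIndex.comap {V : HeytingVariety} {L M : FinPartOrd.{u}}
    {ψ : evalSheaf V L ⟶ evalSheaf V M} {n k : ℕ} (hψ : IsBIndex ψ n) {S : EvalFamily V M}
    (hS : S.HasIndex k) :
    HasIndex (L := L) (fun _ v => S _ (evalSheafApp ψ v)) (n + k) := by
  intro P Q v w p q h hp
  refine hS P Q _ _ p q ?_ hp
  have hb := hψ.bddBisim k (P.down p) (Q.down q) (evalRestrict v p) (evalRestrict w q)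
    ((bddBisim_iff _ _ _).2 ((bisimType_evalRestrict v p _).trans
      (h.trans (bisimType_evalRestrict w q _).symm)))
  rw [← evalRestrict_app, ← evalRestrict_app] at hb
  exact (bisimType_evalRestrict _ p k).symm.trans (((bddBisim_iff _ _ _).1 hb).trans
    (bisimType_evalRestrict _ q k))

/-! ### Natural transformations and Heyting homomorphisms -/

namespace EvalAlgebra

variable {V : HeytingVariety} {L M : FinPartOrd.{u}}

theorem exists_comap {ψ : evalSheaf V L ⟶ evalSheaf V M} (hψ : ∃ n, IsBIndex ψ n)
    (a : EvalAlgebra V M) :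
    ∃ b : EvalAlgebra V L, b.val = fun _ v => a.val _ (evalSheafApp ψ v) := by
  obtain ⟨n, hn⟩ := hψ
  obtain ⟨k, hk⟩ := a.exists_hasIndex
  exact exists_val_eq_of_hasIndex (hk.comap hn)

/-- The Heyting homomorphism induced by a natural transformation that has a b-index. -/
noncomputable def comap {ψ : evalSheaf V L ⟶ evalSheaf V M} (hψ : ∃ n, IsBIndex ψ n) :
    HeytingHom (EvalAlgebra V M) (EvalAlgebra V L) where
  toFun a := (exists_comap hψ a).choose
  map_sup' a b := TermAlgebra.val_injective <|
    (exists_comap hψ _).choose_spec.trans <| by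
      simp only [TermAlgebra.val_sup, (exists_comap hψ a).choose_spec,
        (exists_comap hψ b).choose_spec]
      rfl
  map_inf' a b := TermAlgebra.val_injective <|
    (exists_comap hψ _).choose_spec.trans <| by
      simp only [TermAlgebra.val_inf, (exists_comap hψ a).choose_spec,
        (exists_comap hψ b).choose_spec]
      rfl
  map_bot' := TermAlgebra.val_injective (exists_comap hψ _).choose_spec
  map_himp' a b := TermAlgebra.val_injective <|
    (exists_comap hψ _).choose_spec.trans <| by
      simp only [TermAlgebra.val_himp, (exists_comap hψ a).choose_spec,
        (exists_comap hψ b).choose_spec]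
      rfl

theorem val_comap {ψ : evalSheaf V L ⟶ evalSheaf V M} (hψ : ∃ n, IsBIndex ψ n)
    (a : EvalAlgebra V M) : (comap hψ a).val = fun _ v => a.val _ (evalSheafApp ψ v) :=
  (exists_comap hψ a).choose_spec

theorem mem_comap_unit {ψ : evalSheaf V L ⟶ evalSheaf V M} (hψ : ∃ n, IsBIndex ψ n)
    (d : LowerSet M) {P : PosetCat.{u} V} (v : P.obj →o L) (p : P.obj) :
    p ∈ (comap hψ (unit V M d)).val P v ↔ evalSheafApp ψ v p ∈ d := by
  rw [val_comap, val_unit]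
  rfl

/-- Principal downsets separate the points of `M`. -/
theorem comap_injective {ψ χ : evalSheaf V L ⟶ evalSheaf V M} (hψ : ∃ n, IsBIndex ψ n)
    (hχ : ∃ n, IsBIndex χ n) (h : comap hψ = comap hχ) : ψ = χ := by
  ext P v
  refine OrderHom.ext _ _ (funext fun p => ?_)
  have key : ∀ d : LowerSet M, evalSheafApp ψ v p ∈ d ↔ evalSheafApp χ v p ∈ d := fun d =>
    (mem_comap_unit hψ d v p).symm.trans (h ▸ mem_comap_unit hχ d v p)
  exact le_antisymm ((key (LowerSet.Iic _)).2 le_rfl) ((key (LowerSet.Iic _)).1 le_rfl)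

/-- Heyting homomorphisms between the algebras of evaluation sheaves come from natural
transformations. -/
theorem exists_eq_comap (φ : HeytingHom (EvalAlgebra V M) (EvalAlgebra V L)) :
    ∃ (ψ : evalSheaf V L ⟶ evalSheaf V M) (hψ : ∃ n, IsBIndex ψ n), comap hψ = φ := by
  have dual : ∀ (P : PosetCat.{u} V) (v : P.obj →o L), ∃ w : P.obj →o M,
      ∀ d p, p ∈ (φ (unit V M d)).val P v ↔ w p ∈ d := fun P v =>
    BoundedLatticeHom.exists_orderHom
      { toFun := fun d => (φ (unit V M d)).val P v
        map_sup' := fun a b => by rw [map_sup, map_sup, TermAlgebra.val_sup]; rfl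
        map_inf' := fun a b => by rw [map_inf, map_inf, TermAlgebra.val_inf]; rfl
        map_top' := by rw [map_top, map_top]; rfl
        map_bot' := by rw [map_bot, map_bot]; rfl }
  choose ψ hψ using dual
  choose idx hidx using fun d : LowerSet M => exists_hasIndex (φ (unit V M d))
  have : Finite (LowerSet M) := Finite.of_injective _ SetLike.coe_injective
  -- `LowerSet M` is finite, so one depth serves all generators.
  obtain ⟨n, hn⟩ := (Set.finite_range idx).bddAbove
  have index : ∀ (P Q : PosetCat.{u} V) (v : P.obj →o L) (w : Q.obj →o L) (p : P.obj) (q : Q.obj),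
      bisimType v n p = bisimType w n q → ψ P v p = ψ Q w q := by
    have hle : ∀ (P Q : PosetCat.{u} V) (v : P.obj →o L) (w : Q.obj →o L) (p : P.obj) (q : Q.obj),
        bisimType v n p = bisimType w n q → ψ Q w q ≤ ψ P v p := by
      intro P Q v w p q h
      have := (hidx (LowerSet.Iic (ψ P v p))).mono (hn ⟨_, rfl⟩) P Q v w p q h
        ((hψ P v _ p).2 le_rfl)
      exact (hψ Q w _ q).1 this
    exact fun P Q v w p q h => le_antisymm (hle Q P w v q p h.symm) (hle P Q v w p q h)
  -- `index` is used twice: at all points for naturality, since open maps preserve types, and at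
  -- roots for the b-index.
  let Ψ : evalSheaf V L ⟶ evalSheaf V M :=
    { app := fun P => ↾(fun v => ψ P.unop v)
      naturality := fun P Q f => by
        ext v
        refine OrderHom.ext _ _ (funext fun q => ?_)
        exact index _ _ _ _ _ _ (bisimType_comp v f.unop.hom n q) }
  have hΨ : IsBIndex Ψ n := fun P Q v w h => index P Q v w _ _ ((bddBisim_iff n v w).1 h)
  refine ⟨Ψ, ⟨n, hΨ⟩, hom_ext fun d => TermAlgebra.val_injective ?_⟩
  funext P v
  ext p
  exact (mem_comap_unit _ d v p).trans (hψ P v d p).symm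

end EvalAlgebra

/-! ### The duality functor is an equivalence -/

open EvalAlgebra

/-- The functor sending an evaluation sheaf to its algebra. -/
noncomputable def evalAlgebraFunctor (V : HeytingVariety)
    (hV : HeytingVariety.FinitelyApproximable.{u} V) : (EvalSheafCat.{u} V)ᵒᵖ ⥤ HDCat.{u} V where
  obj X := ⟨HeytAlg.of (EvalAlgebra V X.unop.poset), LowerSet X.unop.poset, inferInstance,
    inferInstance, Finite.of_injective _ SetLike.coe_injective, unit V X.unop.poset,
    isFreeOver_unit hV _⟩
  map f := ObjectProperty.homMk (HeytAlg.ofHom (comap f.unop.2))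
  map_id X := by
    apply ObjectProperty.hom_ext
    ext a
    exact TermAlgebra.val_injective (val_comap (𝟙 X : X ⟶ X).unop.2 a)
  map_comp f g := by
    apply ObjectProperty.hom_ext
    ext a
    apply TermAlgebra.val_injective
    refine (val_comap (f ≫ g).unop.2 a).trans (Eq.trans ?_ (val_comap g.unop.2 _).symm)
    change _ = fun P v => (comap f.unop.2 a).val P _
    rw [val_comap]
    rfl

theorem evalAlgebraFunctor_faithful (V : HeytingVariety)
    (hV : HeytingVariety.FinitelyApproximable.{u} V) : (evalAlgebraFunctor V hV).Faithful where
  map_injective {X Y f g} h := by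
    apply Quiver.Hom.unop_inj
    apply Subtype.ext
    refine comap_injective f.unop.2 g.unop.2 ?_
    exact congrArg (fun k => HeytAlg.Hom.hom (InducedCategory.Hom.hom k)) h

theorem evalAlgebraFunctor_full (V : HeytingVariety)
    (hV : HeytingVariety.FinitelyApproximable.{u} V) : (evalAlgebraFunctor V hV).Full where
  map_surjective {X Y} φ := by
    obtain ⟨ψ, hψ, h⟩ := exists_eq_comap (V := V) (HeytAlg.Hom.hom φ.hom)
    refine ⟨Quiver.Hom.op ⟨ψ, hψ⟩, ?_⟩
    apply ObjectProperty.hom_ext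
    ext a
    exact DFunLike.congr_fun h a

/-- Algebras freely generated by isomorphic distributive lattices are isomorphic. -/
theorem HeytingVariety.IsFreeOver.nonempty_iso {V : HeytingVariety} {D D' : Type u}
    [DistribLattice D] [BoundedOrder D] [DistribLattice D'] [BoundedOrder D'] {A A' : HeytAlg.{u}}
    {η : BoundedLatticeHom D A} {η' : BoundedLatticeHom D' A'} (h : V.IsFreeOver η)
    (h' : V.IsFreeOver η') (e : D ≃o D') : Nonempty (A ≅ A') := by
  obtain ⟨φ, hφ, -⟩ := h.2 A' h'.1 (η'.comp (e : BoundedLatticeHom D D'))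
  obtain ⟨φ', hφ', -⟩ := h'.2 A h.1 (η.comp (e.symm : BoundedLatticeHom D' D))
  have hφ : ∀ d, φ (η d) = η' (e d) := hφ
  have hφ' : ∀ d, φ' (η' d) = η (e.symm d) := hφ'
  refine ⟨⟨HeytAlg.ofHom φ, HeytAlg.ofHom φ', ?_, ?_⟩⟩
  · apply ConcreteCategory.hom_ext
    refine DFunLike.congr_fun ((h.2 A h.1 η).unique (y₁ := φ'.comp φ) (y₂ := HeytingHom.id A) ?_
      fun _ => rfl)
    intro d
    rw [HeytingHom.comp_apply, hφ, hφ', e.symm_apply_apply]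
  · apply ConcreteCategory.hom_ext
    refine DFunLike.congr_fun ((h'.2 A' h'.1 η').unique (y₁ := φ.comp φ')
      (y₂ := HeytingHom.id A') ?_ fun _ => rfl)
    intro d
    rw [HeytingHom.comp_apply, hφ', hφ, e.apply_symm_apply]

/-- Take for `L` the join-irreducibles of `D`: by Birkhoff `D ≅ LowerSet L`, and free algebras over
isomorphic lattices are isomorphic. -/
theorem evalAlgebraFunctor_essSurj (V : HeytingVariety)
    (hV : HeytingVariety.FinitelyApproximable.{u} V) : (evalAlgebraFunctor V hV).EssSurj where
  mem_essImage A := by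
    classical
    obtain ⟨A, D, _, _, _, η, hη⟩ := A
    have := Fintype.ofFinite D
    let L := FinPartOrd.of { d : D // SupIrred d }
    obtain ⟨i⟩ := (isFreeOver_unit hV L).nonempty_iso (A := HeytAlg.of (EvalAlgebra V L)) hη
      OrderIso.lowerSetSupIrred.symm
    exact ⟨op ⟨L⟩, ⟨ObjectProperty.isoMk _ i⟩⟩

theorem mainTheorem2 (V : HeytingVariety) (hV : HeytingVariety.FinitelyApproximable.{u} V) :
    Nonempty ((EvalSheafCat.{u} V)ᵒᵖ ≌ HDCat.{u} V) := by
  have := evalAlgebraFunctor_faithful V hV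
  have := evalAlgebraFunctor_full V hV
  have := evalAlgebraFunctor_essSurj V hV
  have : (evalAlgebraFunctor V hV).IsEquivalence := {}
  exact ⟨(evalAlgebraFunctor V hV).asEquivalence⟩
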